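/- **Setting.** All Hilbert spaces are complex. Let $N\ge 2$, let $K$ be a Hilbert space, and let $V_0,\dots,V_{N-1}$ be bounded operators on $K$ with $\sum_{i}V_iV_i^*=I_K$. Let $(H,S_i)_{i=0}^{N-1}$ be the Cuntz dilation of $(K,V_i)$: $H\supseteq K$ is a Hilbert space, the bounded operators $S_i$ on $H$ satisfy $S_i^*S_j=\delta_{ij}I$ and $\sum_i S_iS_i^*=I$, $S_i^*K\subseteq K$ and $S_i^*|_K=V_i^*$ for all $i$, and $K$ is cyclic for the representation generated by the $S_i$ (the only closed subspace of $H$ that contains $K$ and is invariant under all $S_i$ and $S_i^*$ is $H$). Let $K_0\subseteq K$ be a closed subspace with $V_i^*K_0\subseteq K_0$ for all $i$, with an orthonormal basis $(e_c)_{c\in M}$, $M$ finite and nonempty, and let $\nu_i:M\to\mathbb C$, $g_i:M\to M$ be maps with $V_i^*e_c=\nu_i(c)e_{g_i(c)}$ for all $i$ and $c$, such that $\nu_i(c_1)\ne0$, $\nu_i(c_2)\neq 0$ and $g_i(c_1)=g_i(c_2)$ imply $c_1=c_2$. For a finite word $\omega=\omega_1\dots\omega_n$ over $\{0,\dots,N-1\}$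 (possibly empty) put $S_\omega=S_{\omega_1}\cdots S_{\omega_n}$, $g_\omega=g_{\omega_n}\circ\dots\circ g_{\omega_1}$ and $\nu_\omega(c)=\nu_{\omega_1}(c)\,\nu_{\omega_2}(g_{\omega_1}(c))\cdots\nu_{\omega_n}(g_{\omega_1\dots\omega_{n-1}}(c))$; for the empty word these are $I$, the identity and $1$. Assume that the walk is irreducible (for all $c_1,c_2\in M$ there is a word $\omega$ with $g_\omega(c_1)=c_2$ and $\nu_\omega(c_1)\ne0$), and that $\{V_i\}$ is simple on $K_0$ (the only operators $T$ on $K_0$ with $P_{K_0}\big(\sum_iV_iTV_i^*\big)P_{K_0}=T$ are the scalar multiples of $I_{K_0}$). A *cycle word* for $c\in M$ is a nonempty word $\beta$ with $g_\beta(c)=c$, $\nu_\beta(c)\neq0$, and $g_\gamma(c)\ne c$ for every nonempty proper prefix $\gamma$ of $\beta$. A *loop* for $c$ is a word $\gamma$ that is empty or satisfies $g_\gamma(c)=c$ and $\nu_\gamma(c)\ne0$. Let $\Omega_c^{(0)}$ be the set of words that do not end in a cycle word for $c$; for $n\ge1$ let $\Omega_c^{(n)}$ be the set of words $\omega_0\beta_1\dots\beta_n$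 with $\omega_0\in\Omega_c^{(0)}$ and $\beta_1,\dots,\beta_n$ cycle words for $c$. Let $V^{(c)}=\overline{\operatorname{span}}\{S_\omega e_c:\omega \text{ any word}\}$. **Proposition.** (1) Suppose that $|\nu_i(c)|\in\{0,1\}$ for all $c\in M$ and all $i$. Then: - $M$ is a single cycle: its elements can be listed without repetition as $x_0,\dots,x_{p-1}$ so that, for each $k$, there is exactly one $i$ with $\nu_i(x_k)\ne0$, and for this $i$ one has $g_i(x_k)=x_{k+1}$ (indices mod $p$); - $\{V_i\}$ is reversing: $V_ie_{g_i(c)}=\overline{\nu_i(c)}\,e_c$ whenever $\nu_i(c)\neq0$; - for all $c\in M$ and $n\ge0$ and every $\omega=\omega_0\gamma\in\Omega_c^{(n)}$ with $\omega_0\in\Omega_c^{(0)}$ and $\gamma$ a loop for $c$, the vector $S_\omega e_c$ is a unimodular constant multiple of $S_{\omega_0}e_c$; - for every $c\in M$, the family $(S_\omega e_c)_{\omega\in\Omega_c^{(0)}}$ is an orthonormal basis of $V^{(c)}$. (2) If $c\in M$ and $\nu_i(c)\ne0$ for at least two distinct $i$, then for every $n\ge0$ the family $\{S_\omega e_c:\omega\in\Omega_c^{(n)}\}$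 is incomplete in $V^{(c)}$, that is, $\overline{\operatorname{span}}\{S_\omega e_c:\omega\in\Omega_c^{(n)}\}\ne V^{(c)}$. -/

import Mathlib

open scoped InnerProduct ComplexConjugate

namespace CuntzWalk

section Operators

/-- `(K, V_i)` is a row co-isometry: `N ≥ 2` and `∑ V_i V_i^* = I_K`. -/
structure IsRowCoisometry {N : ℕ} {K : Type*} [NormedAddCommGroup K] [InnerProductSpace ℂ K]
    [CompleteSpace K] (V : Fin N → K →L[ℂ] K) : Prop where
  two_le : 2 ≤ N
  sum_eq : ∑ i, V i ∘L (V i)† = ContinuousLinearMap.id ℂ K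

/-- `S_0, …, S_{N-1}` satisfy the Cuntz relations `S_i^* S_j = δ_{ij} I`, `∑ S_i S_i^* = I`. -/
structure IsCuntzFamily {N : ℕ} {H : Type*} [NormedAddCommGroup H] [InnerProductSpace ℂ H]
    [CompleteSpace H] (S : Fin N → H →L[ℂ] H) : Prop where
  isometry : ∀ i, (S i)† ∘L S i = ContinuousLinearMap.id ℂ H
  orthogonal : ∀ i j, i ≠ j → (S i)† ∘L S j = 0
  sum_eq : ∑ i, S i ∘L (S i)† = ContinuousLinearMap.id ℂ H

/-- `(H, S_i)` is the Cuntz dilation of `(K, V_i)`, where `K` is embedded into `H` by the linear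
isometry `ι`: the `S_i` satisfy the Cuntz relations, `K` is invariant under every `S_i^*` and `S_i^*`
restricts to `V_i^*` on `K` (so that, with `p` the projection onto `K`, also `p S_i = p S_i p` and
`V_i = p S_i` on `K`), and `K` is cyclic for the representation. -/
structure IsCuntzDilation {N : ℕ} {K H : Type*} [NormedAddCommGroup K] [InnerProductSpace ℂ K]
    [CompleteSpace K] [NormedAddCommGroup H] [InnerProductSpace ℂ H] [CompleteSpace H]
    (V : Fin N → K →L[ℂ] K) (ι : K →ₗᵢ[ℂ] H) (S : Fin N → H →L[ℂ] H) : Prop where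
  cuntz : IsCuntzFamily S
  adjoint_apply : ∀ i k, ((S i)†) (ι k) = ι (((V i)†) k)
  cyclic : ∀ W : Submodule ℂ H, IsClosed (W : Set H) → (∀ k, ι k ∈ W) →
    (∀ i, ∀ x ∈ W, S i x ∈ W) → (∀ i, ∀ x ∈ W, ((S i)†) x ∈ W) → W = ⊤

/-- `S_ω = S_{ω_1} ⋯ S_{ω_n}` for a word `ω = ω_1 … ω_n` (the identity for the empty word). -/
noncomputable def wordOp {N : ℕ} {H : Type*} [NormedAddCommGroup H] [InnerProductSpace ℂ H]
    (S : Fin N → H →L[ℂ] H) (ω : List (Fin N)) : H →L[ℂ] H :=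
  (ω.map S).prod

/-- The closed linear span of `{S_ω v : ω ∈ A}`. -/
noncomputable def wordSpan {N : ℕ} {H : Type*} [NormedAddCommGroup H] [InnerProductSpace ℂ H]
    (S : Fin N → H →L[ℂ] H) (v : H) (A : Set (List (Fin N))) : Submodule ℂ H :=
  (Submodule.span ℂ ((fun ω => wordOp S ω v) '' A)).topologicalClosure

end Operators

section Graph

/-- `g_ω = g_{ω_n} ∘ ⋯ ∘ g_{ω_1}` for `ω = ω_1 … ω_n`. -/
def wordMap {N : ℕ} {M : Type*} (g : Fin N → M → M) : List (Fin N) → M → M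
  | [], c => c
  | i :: ω, c => wordMap g ω (g i c)

/-- `ν_ω(c) = ν_{ω_1}(c) ν_{ω_2}(g_{ω_1}(c)) ⋯ ν_{ω_n}(g_{ω_1 … ω_{n-1}}(c))`. -/
def wordWeight {N : ℕ} {M : Type*} (g : Fin N → M → M) (ν : Fin N → M → ℂ) :
    List (Fin N) → M → ℂ
  | [], _ => 1
  | i :: ω, c => ν i c * wordWeight g ν ω (g i c)

/-- Every vertex can be reached from every vertex with positive probability. -/
def IsIrreducibleWalk {N : ℕ} {M : Type*} (g : Fin N → M → M) (ν : Fin N → M → ℂ) : Prop :=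
  ∀ c₁ c₂ : M, ∃ ω : List (Fin N), wordMap g ω c₁ = c₂ ∧ wordWeight g ν ω c₁ ≠ 0

/-- `β` is a cycle word for `c`: a nonempty word along which `c` returns to `c` with positive
probability, and not earlier than at the end of the word. -/
structure IsCycleWord {N : ℕ} {M : Type*} (g : Fin N → M → M) (ν : Fin N → M → ℂ) (c : M)
    (β : List (Fin N)) : Prop where
  ne_nil : β ≠ []
  returns : wordMap g β c = c
  first : ∀ γ : List (Fin N), γ <+: β → γ ≠ [] → γ ≠ β → wordMap g γ c ≠ c
  possible : wordWeight g ν β c ≠ 0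

/-- `β` is a loop for `c`: it is empty, or `c` returns to `c` along it with positive probability. -/
def IsLoop {N : ℕ} {M : Type*} (g : Fin N → M → M) (ν : Fin N → M → ℂ) (c : M)
    (β : List (Fin N)) : Prop :=
  β = [] ∨ (wordMap g β c = c ∧ wordWeight g ν β c ≠ 0)

/-- The words that do not end in a cycle word for `c`. -/
def wordsZero {N : ℕ} {M : Type*} (g : Fin N → M → M) (ν : Fin N → M → ℂ) (c : M) :
    Set (List (Fin N)) :=
  {ω | ∀ β, IsCycleWord g ν c β → ¬ β <:+ ω}

/-- The words `ω₀ β₁ … β_n` with `β₁, …, β_n` cycle words for `c` and `ω₀` not ending in a cycle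
word for `c`. -/
def wordsEnding {N : ℕ} {M : Type*} (g : Fin N → M → M) (ν : Fin N → M → ℂ) (c : M) (n : ℕ) :
    Set (List (Fin N)) :=
  {ω | ∃ ω₀ ∈ wordsZero g ν c, ∃ βs : List (List (Fin N)),
    βs.length = n ∧ (∀ β ∈ βs, IsCycleWord g ν c β) ∧ ω = ω₀ ++ βs.flatten}

theorem wordsEnding_zero {N : ℕ} {M : Type*} (g : Fin N → M → M) (ν : Fin N → M → ℂ) (c : M) :
    wordsEnding g ν c 0 = wordsZero g ν c := by
  ext ω
  constructor
  · rintro ⟨ω₀, h₀, βs, hlen, -, rfl⟩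
    obtain rfl := List.length_eq_zero_iff.mp hlen
    simpa using h₀
  · intro h
    exact ⟨ω, h, [], rfl, by simp, by simp⟩

/-- The graph of possible transitions is a single cycle: the vertices can be listed cyclically
without repetition as `x_0, …, x_{p-1}`, `p ≥ 1`, so that from each `x_k` exactly one edge is
possible, and it leads to `x_{k+1}` (indices mod `p`). -/
def IsSingleCycle {N : ℕ} {M : Type*} (g : Fin N → M → M) (ν : Fin N → M → ℂ) : Prop :=
  ∃ p : ℕ, 0 < p ∧ ∃ (x : ZMod p ≃ M) (d : ZMod p → Fin N),
    ∀ k, (∀ i, ν i (x k) ≠ 0 ↔ i = d k) ∧ g (d k) (x k) = x (k + 1)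

end Graph

section Walk

/-- `(V_i)` acts on `K₀`, with orthonormal basis `(e_c)`, as a random walk on the graph
`(M, {g_i}, {ν_i})`. -/
structure ActsAsRandomWalk {N : ℕ} {K M : Type*} [NormedAddCommGroup K] [InnerProductSpace ℂ K]
    [CompleteSpace K] [Fintype M] (V : Fin N → K →L[ℂ] K) (K₀ : Submodule ℂ K)
    (e : OrthonormalBasis M ℂ K₀) (g : Fin N → M → M) (ν : Fin N → M → ℂ) : Prop where
  invariant : ∀ i, ∀ x ∈ K₀, ((V i)†) x ∈ K₀
  adjoint_apply : ∀ i c, ((V i)†) (e c : K) = ν i c • (e (g i c) : K)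
  injective : ∀ i c₁ c₂, ν i c₁ ≠ 0 → ν i c₂ ≠ 0 → g i c₁ = g i c₂ → c₁ = c₂

/-- `(V_i)` is simple on `K₀`: the only operators `T` on `K₀` with
`P_{K₀} (∑ V_i T V_i^*) P_{K₀} = T` are the scalars. Here `T` is viewed on `K` as `T P_{K₀}`. -/
def IsSimpleOn {N : ℕ} {K : Type*} [NormedAddCommGroup K] [InnerProductSpace ℂ K]
    [CompleteSpace K] (V : Fin N → K →L[ℂ] K) (K₀ : Submodule ℂ K) [CompleteSpace K₀] : Prop :=
  ∀ T : K₀ →L[ℂ] K₀,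
    K₀.orthogonalProjectionOnto ∘L
      (∑ i, V i ∘L (K₀.subtypeL ∘L T ∘L K₀.orthogonalProjectionOnto) ∘L (V i)†) ∘L K₀.subtypeL = T →
    ∃ z : ℂ, T = z • ContinuousLinearMap.id ℂ K₀

/-- `(V_i)` is reversing on the random walk. -/
def IsReversing {N : ℕ} {K M : Type*} [NormedAddCommGroup K] [InnerProductSpace ℂ K]
    [Fintype M] (V : Fin N → K →L[ℂ] K) {K₀ : Submodule ℂ K}
    (e : OrthonormalBasis M ℂ K₀) (g : Fin N → M → M) (ν : Fin N → M → ℂ) : Prop :=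
  ∀ i c, ν i c ≠ 0 → V i (e (g i c) : K) = conj (ν i c) • (e c : K)

end Walk

end CuntzWalk

/-!
The relation `S_i^* e_c = ν_i(c) e_{g_i(c)}` gives
`⟪e_c, S_τ v⟫ = conj (ν_τ(c)) ⟪e_{g_τ(c)}, v⟫`, so `S_ω e_c` and `S_ω' e_c` can only fail to be
orthogonal when one of `ω`, `ω'` extends the other by a loop for `c`. Every word is uniquely a
word of `Ω_c^{(0)}` followed by a loop, and every loop is uniquely a product of cycle words; hence
each family `(S_ω e_c)_{ω ∈ Ω_c^{(n)}}` is orthonormal.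

If all weights have modulus `0` or `1`, equality in the Cauchy–Schwarz inequality gives
`S_τ e_{g_τ(c)} = conj (ν_τ(c)) e_c` along every possible path, so loops act on `e_c` as unimodular
scalars. If two edges leave `c`, a cycle word `β` for `c` has `|ν_β(c)| < 1`, and for
`b ∈ Ω_c^{(n)}` the nonzero vector `S_{bβ} e_c - conj (ν_β(c)) S_b e_c` is orthogonal to the whole
family at level `n`.
-/

namespace CuntzWalk

section Words

variable {N : ℕ} {M : Type*} {g : Fin N → M → M} {ν : Fin N → M → ℂ} {c : M}

/-- The walk is codeterministic, in the sense of automata theory: for each letter, at most one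
possible edge with that label enters a given vertex. -/
def IsCodeterministic (g : Fin N → M → M) (ν : Fin N → M → ℂ) : Prop :=
  ∀ i c₁ c₂, ν i c₁ ≠ 0 → ν i c₂ ≠ 0 → g i c₁ = g i c₂ → c₁ = c₂

theorem wordMap_append (σ τ : List (Fin N)) (c : M) :
    wordMap g (σ ++ τ) c = wordMap g τ (wordMap g σ c) := by
  induction σ generalizing c with
  | nil => rfl
  | cons i _ ih => exact ih _

theorem wordWeight_append (σ τ : List (Fin N)) (c : M) :
    wordWeight g ν (σ ++ τ) c = wordWeight g ν σ c * wordWeight g ν τ (wordMap g σ c) := by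
  induction σ generalizing c with
  | nil => exact (one_mul _).symm
  | cons i σ ih => simp only [List.cons_append, wordWeight, wordMap, ih, mul_assoc]

theorem norm_wordWeight_eq_one (h01 : ∀ c i, ‖ν i c‖ = 0 ∨ ‖ν i c‖ = 1) {τ : List (Fin N)} {c : M}
    (hτ : wordWeight g ν τ c ≠ 0) : ‖wordWeight g ν τ c‖ = 1 := by
  induction τ generalizing c with
  | nil => exact norm_one
  | cons i τ ih =>
    rw [wordWeight, mul_ne_zero_iff] at hτ
    rw [wordWeight, norm_mul, ih hτ.2, mul_one]
    exact (h01 c i).resolve_left (norm_ne_zero_iff.2 hτ.1)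

theorem IsCodeterministic.eq_of_wordMap_eq (hg : IsCodeterministic g ν) (τ : List (Fin N))
    {c₁ c₂ : M} (h₁ : wordWeight g ν τ c₁ ≠ 0) (h₂ : wordWeight g ν τ c₂ ≠ 0)
    (h : wordMap g τ c₁ = wordMap g τ c₂) : c₁ = c₂ := by
  induction τ generalizing c₁ c₂ with
  | nil => exact h
  | cons i τ ih =>
    rw [wordWeight, mul_ne_zero_iff] at h₁ h₂
    exact hg i c₁ c₂ h₁.1 h₂.1 (ih h₁.2 h₂.2 h)

theorem isLoop_iff {τ : List (Fin N)} :
    IsLoop g ν c τ ↔ wordMap g τ c = c ∧ wordWeight g ν τ c ≠ 0 :=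
  or_iff_right_of_imp (by rintro rfl; exact ⟨rfl, one_ne_zero⟩)

theorem isLoop_nil : IsLoop g ν c [] := Or.inl rfl

theorem IsCycleWord.isLoop {β : List (Fin N)} (h : IsCycleWord g ν c β) : IsLoop g ν c β :=
  Or.inr ⟨h.returns, h.possible⟩

theorem IsLoop.append_iff_right {σ τ : List (Fin N)} (hσ : IsLoop g ν c σ) :
    IsLoop g ν c (σ ++ τ) ↔ IsLoop g ν c τ := by
  obtain ⟨hret, hpos⟩ := isLoop_iff.1 hσ
  rw [isLoop_iff, isLoop_iff, wordMap_append, wordWeight_append, hret, mul_ne_zero_iff,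
    and_iff_right hpos]

theorem IsLoop.append_iff_left (hg : IsCodeterministic g ν) {σ τ : List (Fin N)}
    (hτ : IsLoop g ν c τ) : IsLoop g ν c (σ ++ τ) ↔ IsLoop g ν c σ := by
  refine ⟨fun h => ?_, fun hσ => hσ.append_iff_right.2 hτ⟩
  obtain ⟨hret, hpos⟩ := isLoop_iff.1 h
  obtain ⟨hretτ, hposτ⟩ := isLoop_iff.1 hτ
  rw [wordMap_append] at hret
  rw [wordWeight_append, mul_ne_zero_iff] at hpos
  exact isLoop_iff.2 ⟨hg.eq_of_wordMap_eq τ hpos.2 hposτ (hret.trans hretτ.symm), hpos.1⟩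

theorem IsLoop.exists_eq_flatten {τ : List (Fin N)} (hτ : IsLoop g ν c τ) :
    ∃ βs : List (List (Fin N)), (∀ β ∈ βs, IsCycleWord g ν c β) ∧ βs.flatten = τ := by
  induction hn : τ.length using Nat.strong_induction_on generalizing τ with
  | _ n ih =>
    subst hn
    obtain ⟨hret, hpos⟩ := isLoop_iff.1 hτ
    by_cases hnil : τ = []
    · exact ⟨[], by simp, hnil.symm⟩
    by_cases hfirst : ∀ γ, γ <+: τ → γ ≠ [] → γ ≠ τ → wordMap g γ c ≠ c
    · exact ⟨[τ], by simpa using ⟨hnil, hret, hfirst, hpos⟩, by simp⟩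
    push Not at hfirst
    obtain ⟨γ, ⟨δ, rfl⟩, hγ, hγδ, hγret⟩ := hfirst
    have hγloop : IsLoop g ν c γ :=
      isLoop_iff.2 ⟨hγret, fun h => hpos (by rw [wordWeight_append, h, zero_mul])⟩
    have hδ : δ ≠ [] := by rintro rfl; simp at hγδ
    have hγ_lt : γ.length < (γ ++ δ).length := by simpa [List.length_pos_iff] using hδ
    have hδ_lt : δ.length < (γ ++ δ).length := by simpa [List.length_pos_iff] using hγ
    obtain ⟨αs, hαs, rfl⟩ := ih γ.length hγ_lt hγloop rfl
    obtain ⟨βs, hβs, rfl⟩ := ih δ.length hδ_lt (hγloop.append_iff_right.1 hτ) rfl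
    exact ⟨αs ++ βs, List.forall_mem_append.2 ⟨hαs, hβs⟩, List.flatten_append⟩

theorem isLoop_flatten {βs : List (List (Fin N))} (hβs : ∀ β ∈ βs, IsCycleWord g ν c β) :
    IsLoop g ν c βs.flatten := by
  induction βs with
  | nil => exact isLoop_nil
  | cons β βs ih =>
    rw [List.forall_mem_cons] at hβs
    exact hβs.1.isLoop.append_iff_right.2 (ih hβs.2)

theorem IsLoop.exists_isCycleWord_suffix {τ : List (Fin N)} (hτ : IsLoop g ν c τ) (hne : τ ≠ []) :
    ∃ β, IsCycleWord g ν c β ∧ β <:+ τ := by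
  obtain ⟨βs, hβs, rfl⟩ := hτ.exists_eq_flatten
  obtain rfl | ⟨αs, β, rfl⟩ := List.eq_nil_or_concat' βs
  · exact absurd rfl hne
  · exact ⟨β, hβs β (by simp), αs.flatten, by simp⟩

theorem IsIrreducibleWalk.exists_isCycleWord (hirr : IsIrreducibleWalk g ν) {i : Fin N}
    (hi : ν i c ≠ 0) : ∃ β, IsCycleWord g ν c β := by
  obtain ⟨τ, hret, hpos⟩ := hirr (g i c) c
  have hloop : IsLoop g ν c (i :: τ) := Or.inr ⟨hret, mul_ne_zero hi hpos⟩
  obtain ⟨β, hβ, -⟩ := hloop.exists_isCycleWord_suffix (List.cons_ne_nil i τ)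
  exact ⟨β, hβ⟩

theorem uniquelyDecodable_of_prefixFree {α : Type*} {A : Set (List α)} (hnil : [] ∉ A)
    (hA : ∀ a ∈ A, ∀ b ∈ A, a <+: b → a = b) : InformationTheory.UniquelyDecodable A := by
  intro as
  induction as with
  | nil =>
    rintro (_ | ⟨b, bs⟩) - hbs h
    · rfl
    · exact absurd (hbs b (by simp)) (by simp_all)
  | cons a as ih =>
    rintro (_ | ⟨b, bs⟩) has hbs h
    · exact absurd (has a (by simp)) (by simp_all)
    rw [List.forall_mem_cons] at has hbs
    rw [List.flatten_cons, List.flatten_cons] at h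
    obtain rfl : a = b := by
      rcases List.prefix_or_prefix_of_prefix (List.prefix_append a _)
        (h ▸ List.prefix_append b _) with hab | hba
      · exact hA a has.1 b hbs.1 hab
      · exact (hA b hbs.1 a has.1 hba).symm
    rw [ih bs has.2 hbs.2 (List.append_cancel_left h)]

theorem uniquelyDecodable_setOf_isCycleWord :
    InformationTheory.UniquelyDecodable {β | IsCycleWord g ν c β} := by
  refine uniquelyDecodable_of_prefixFree (fun h => h.ne_nil rfl) fun α hα β hβ hαβ => ?_
  by_contra hne
  exact hβ.first α hαβ hα.ne_nil hne hα.returns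

theorem mem_wordsZero_iff {ω : List (Fin N)} :
    ω ∈ wordsZero g ν c ↔ ∀ τ, IsLoop g ν c τ → τ <:+ ω → τ = [] := by
  refine ⟨fun h τ hτ hτω => ?_, fun h β hβ hβω => hβ.ne_nil (h β hβ.isLoop hβω)⟩
  by_contra hne
  obtain ⟨β, hβ, hβτ⟩ := hτ.exists_isCycleWord_suffix hne
  exact h β hβ (hβτ.trans hτω)

theorem nil_mem_wordsZero : [] ∈ wordsZero g ν c :=
  fun _ hβ h => hβ.ne_nil (List.suffix_nil.1 h)

theorem exists_wordsZero_append_isLoop (g : Fin N → M → M) (ν : Fin N → M → ℂ) (c : M)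
    (ω : List (Fin N)) : ∃ ω₀ ∈ wordsZero g ν c, ∃ γ, IsLoop g ν c γ ∧ ω₀ ++ γ = ω := by
  induction hn : ω.length using Nat.strong_induction_on generalizing ω with
  | _ n ih =>
    subst hn
    by_cases hω : ω ∈ wordsZero g ν c
    · exact ⟨ω, hω, [], isLoop_nil, List.append_nil ω⟩
    · rw [mem_wordsZero_iff] at hω
      push Not at hω
      obtain ⟨τ, hτ, ⟨ω', rfl⟩, hne⟩ := hω
      obtain ⟨ω₀, hω₀, γ, hγ, rfl⟩ :=
        ih ω'.length (by simpa [List.length_pos_iff] using hne) ω' rfl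
      exact ⟨ω₀, hω₀, γ ++ τ, hγ.append_iff_right.2 hτ, (List.append_assoc ω₀ γ τ).symm⟩

theorem wordsZero_append_isLoop_inj (hg : IsCodeterministic g ν) {ω ω' γ γ' : List (Fin N)}
    (hω : ω ∈ wordsZero g ν c) (hω' : ω' ∈ wordsZero g ν c) (hγ : IsLoop g ν c γ)
    (hγ' : IsLoop g ν c γ') (h : ω ++ γ = ω' ++ γ') : ω = ω' ∧ γ = γ' := by
  rcases List.append_eq_append_iff.1 h with ⟨δ, rfl, rfl⟩ | ⟨δ, rfl, rfl⟩
  · obtain rfl := mem_wordsZero_iff.1 hω' δ ((hγ'.append_iff_left hg).1 hγ)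
      (List.suffix_append ω δ)
    simp
  · obtain rfl := mem_wordsZero_iff.1 hω δ ((hγ.append_iff_left hg).1 hγ')
      (List.suffix_append ω' δ)
    simp

theorem flatten_replicate_mem_wordsEnding {β : List (Fin N)} (hβ : IsCycleWord g ν c β) (n : ℕ) :
    (List.replicate n β).flatten ∈ wordsEnding g ν c n :=
  ⟨[], nil_mem_wordsZero, List.replicate n β, List.length_replicate,
    fun _ hα => List.eq_of_mem_replicate hα ▸ hβ, rfl⟩

theorem wordsEnding_eq_of_append_isLoop_eq (hg : IsCodeterministic g ν) {n : ℕ}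
    {ω ω' τ τ' : List (Fin N)} (hω : ω ∈ wordsEnding g ν c n) (hω' : ω' ∈ wordsEnding g ν c n)
    (hτ : IsLoop g ν c τ) (hτ' : IsLoop g ν c τ') (h : ω ++ τ = ω' ++ τ') : ω = ω' := by
  obtain ⟨ω₀, hω₀, βs, hlen, hβs, rfl⟩ := hω
  obtain ⟨ω₀', hω₀', βs', hlen', hβs', rfl⟩ := hω'
  obtain ⟨αs, hαs, rfl⟩ := hτ.exists_eq_flatten
  obtain ⟨αs', hαs', rfl⟩ := hτ'.exists_eq_flatten
  have hall := List.forall_mem_append.2 ⟨hβs, hαs⟩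
  have hall' := List.forall_mem_append.2 ⟨hβs', hαs'⟩
  rw [List.append_assoc, List.append_assoc, ← List.flatten_append, ← List.flatten_append] at h
  obtain ⟨rfl, hflat⟩ :=
    wordsZero_append_isLoop_inj hg hω₀ hω₀' (isLoop_flatten hall) (isLoop_flatten hall') h
  have hcycles : βs ++ αs = βs' ++ αs' := uniquelyDecodable_setOf_isCycleWord _ _ hall hall' hflat
  rw [List.append_inj_left hcycles (hlen.trans hlen'.symm)]

end Words

section SingleCycle

variable {N : ℕ} {M : Type*} {g : Fin N → M → M} {ν : Fin N → M → ℂ}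

theorem exists_zmod_equiv_of_iterate_reaches [Nonempty M] {f : M → M}
    (hf : ∀ a b, ∃ n, f^[n] a = b) :
    ∃ p : ℕ, 0 < p ∧ ∃ x : ZMod p ≃ M, ∀ k, f (x k) = x (k + 1) := by
  obtain ⟨a⟩ := ‹Nonempty M›
  set p := Function.minimalPeriod f a
  have hp_pos : 0 < p := by
    obtain ⟨n, hn⟩ := hf (f a) a
    exact Function.IsPeriodicPt.minimalPeriod_pos n.succ_pos hn
  have : NeZero p := ⟨hp_pos.ne'⟩
  have hmod (n : ℕ) : f^[n % p] a = f^[n] a := Function.iterate_mod_minimalPeriod_eq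
  have hbij : Function.Bijective fun k : ZMod p => f^[k.val] a := by
    refine ⟨fun k l hkl => ZMod.val_injective p ?_, fun b => ?_⟩
    · exact Function.iterate_injOn_Iio_minimalPeriod k.val_lt l.val_lt hkl
    · obtain ⟨n, rfl⟩ := hf a b
      exact ⟨n, by simp only [ZMod.val_natCast, hmod]⟩
  refine ⟨p, hp_pos, Equiv.ofBijective _ hbij, fun k => ?_⟩
  simp only [Equiv.ofBijective_apply]
  rw [← Function.iterate_succ_apply' f, ZMod.val_add, ZMod.val_one_eq_one_mod, Nat.add_mod_mod,
    hmod]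

theorem IsIrreducibleWalk.isSingleCycle [Nonempty M] (hirr : IsIrreducibleWalk g ν)
    (hdet : ∀ c, ∃ d, ∀ i, ν i c ≠ 0 ↔ i = d) : IsSingleCycle g ν := by
  choose d hd using hdet
  have hiter (τ : List (Fin N)) (c : M) (hτ : wordWeight g ν τ c ≠ 0) :
      (fun c => g (d c) c)^[τ.length] c = wordMap g τ c := by
    induction τ generalizing c with
    | nil => rfl
    | cons i τ ih =>
      rw [wordWeight, mul_ne_zero_iff] at hτ
      obtain rfl := (hd c i).1 hτ.1
      exact ih _ hτ.2
  obtain ⟨p, hp, x, hx⟩ := exists_zmod_equiv_of_iterate_reaches fun a b =>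
    let ⟨τ, hτ, hpos⟩ := hirr a b
    ⟨τ.length, (hiter τ a hpos).trans hτ⟩
  exact ⟨p, hp, x, fun k => d (x k), fun k => ⟨hd (x k), hx k⟩⟩

end SingleCycle

section UnitVectors

variable {ι F : Type*} [Fintype ι] [NormedAddCommGroup F] {a : ι → F}

theorem norm_lt_one_of_sum_norm_sq_eq_one (ha : ∑ i, ‖a i‖ ^ 2 = 1) {i j : ι} (hij : i ≠ j)
    (hj : a j ≠ 0) : ‖a i‖ < 1 := by
  have hle : ‖a i‖ ^ 2 + ‖a j‖ ^ 2 ≤ 1 :=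
    ha ▸ Finset.add_le_sum (fun k _ => sq_nonneg ‖a k‖) (Finset.mem_univ i) (Finset.mem_univ j) hij
  have hpos : 0 < ‖a j‖ ^ 2 := by positivity
  exact (sq_lt_one_iff₀ (norm_nonneg _)).1 (by linarith)

theorem exists_ne_zero_iff_eq_of_sum_norm_sq_eq_one (ha : ∑ i, ‖a i‖ ^ 2 = 1)
    (h01 : ∀ i, ‖a i‖ = 0 ∨ ‖a i‖ = 1) : ∃ d, ∀ i, a i ≠ 0 ↔ i = d := by
  obtain ⟨d, hd⟩ : ∃ d, a d ≠ 0 := by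
    by_contra! hzero
    simp [hzero] at ha
  refine ⟨d, fun i => ⟨fun hi => ?_, fun h => h ▸ hd⟩⟩
  by_contra hne
  exact (norm_lt_one_of_sum_norm_sq_eq_one ha hne hd).ne
    ((h01 i).resolve_left (norm_ne_zero_iff.2 hi))

end UnitVectors

section WordOperators

variable {N : ℕ} {H : Type*} [NormedAddCommGroup H] [InnerProductSpace ℂ H]
  {S : Fin N → H →L[ℂ] H}

theorem wordOp_nil (x : H) : wordOp S [] x = x := rfl

theorem wordOp_cons (i : Fin N) (ω : List (Fin N)) (x : H) :
    wordOp S (i :: ω) x = S i (wordOp S ω x) := by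
  simp [wordOp]

theorem wordOp_append (σ τ : List (Fin N)) (x : H) :
    wordOp S (σ ++ τ) x = wordOp S σ (wordOp S τ x) := by
  simp [wordOp]

theorem wordOp_mem_wordSpan {A : Set (List (Fin N))} {ω : List (Fin N)} (hω : ω ∈ A) (v : H) :
    wordOp S ω v ∈ wordSpan S v A :=
  Submodule.le_topologicalClosure _ (Submodule.subset_span (Set.mem_image_of_mem _ hω))

theorem mem_orthogonal_wordSpan {v x : H} {A : Set (List (Fin N))}
    (h : ∀ ω ∈ A, inner ℂ (wordOp S ω v) x = 0) : x ∈ (wordSpan S v A)ᗮ := by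
  rw [wordSpan, Submodule.orthogonal_closure, ← Submodule.span_singleton_le_iff_mem,
    ← Submodule.isOrtho_iff_le, Submodule.isOrtho_comm, Submodule.isOrtho_span]
  rintro _ ⟨ω, hω, rfl⟩ _ rfl
  exact h ω hω

variable [CompleteSpace H]

theorem IsCuntzFamily.inner_apply (hS : IsCuntzFamily S) (i : Fin N) (x y : H) :
    inner ℂ (S i x) (S i y) = inner ℂ x y := by
  rw [← ContinuousLinearMap.adjoint_inner_right, ← ContinuousLinearMap.comp_apply, hS.isometry,
    ContinuousLinearMap.id_apply]

theorem IsCuntzFamily.inner_apply_of_ne (hS : IsCuntzFamily S) {i j : Fin N} (hij : i ≠ j)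
    (x y : H) : inner ℂ (S i x) (S j y) = 0 := by
  rw [← ContinuousLinearMap.adjoint_inner_right, ← ContinuousLinearMap.comp_apply,
    hS.orthogonal i j hij, zero_apply, inner_zero_right]

theorem IsCuntzFamily.inner_wordOp (hS : IsCuntzFamily S) (ω : List (Fin N)) (x y : H) :
    inner ℂ (wordOp S ω x) (wordOp S ω y) = inner ℂ x y := by
  induction ω with
  | nil => rfl
  | cons i ω ih => rw [wordOp_cons, wordOp_cons, hS.inner_apply, ih]

theorem IsCuntzFamily.norm_wordOp (hS : IsCuntzFamily S) (ω : List (Fin N)) (x : H) :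
    ‖wordOp S ω x‖ = ‖x‖ := by
  rw [norm_eq_sqrt_re_inner (𝕜 := ℂ), hS.inner_wordOp, ← norm_eq_sqrt_re_inner]

theorem IsCuntzFamily.sum_norm_sq_adjoint_apply (hS : IsCuntzFamily S) (x : H) :
    ∑ i, ‖((S i)†) x‖ ^ 2 = ‖x‖ ^ 2 := by
  simp_rw [ContinuousLinearMap.apply_norm_sq_eq_inner_adjoint_left,
    ContinuousLinearMap.adjoint_adjoint]
  rw [← map_sum, ← sum_inner, ← sum_apply, hS.sum_eq, ContinuousLinearMap.id_apply,
    ← norm_sq_eq_re_inner]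

end WordOperators

section Representation

variable {N : ℕ} {H M : Type*} [NormedAddCommGroup H] [InnerProductSpace ℂ H] [CompleteSpace H]
  {S : Fin N → H →L[ℂ] H} {E : M → H} {g : Fin N → M → M} {ν : Fin N → M → ℂ}

/-- The adjoints `S_i^*` move the vectors `E_c` along the edges of the walk,
`S_i^* E_c = ν_i(c) E_{g_i(c)}`. It is meant for both `(K, V_i, e)` and its image in the
dilation. -/
def FollowsWalk (S : Fin N → H →L[ℂ] H) (E : M → H) (g : Fin N → M → M) (ν : Fin N → M → ℂ) :
    Prop :=
  ∀ i c, ((S i)†) (E c) = ν i c • E (g i c)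

theorem FollowsWalk.map {K : Type*} [NormedAddCommGroup K] [InnerProductSpace ℂ K]
    [CompleteSpace K] {V : Fin N → K →L[ℂ] K} {e : M → K} (hV : FollowsWalk V e g ν)
    {ι : K →ₗᵢ[ℂ] H} (hι : ∀ i k, ((S i)†) (ι k) = ι (((V i)†) k)) :
    FollowsWalk S (fun c => ι (e c)) g ν := fun i c => by
  rw [hι, hV i c, map_smul]

theorem FollowsWalk.inner_wordOp_right (hwalk : FollowsWalk S E g ν) (τ : List (Fin N)) (c : M)
    (v : H) :
    inner ℂ (E c) (wordOp S τ v) =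
      conj (wordWeight g ν τ c) * inner ℂ (E (wordMap g τ c)) v := by
  induction τ generalizing c with
  | nil => simp only [wordOp_nil, wordWeight, wordMap, map_one, one_mul]
  | cons i τ ih =>
    rw [wordOp_cons, ← ContinuousLinearMap.adjoint_inner_left, hwalk, inner_smul_left, ih,
      wordWeight, wordMap, map_mul, mul_assoc]

theorem FollowsWalk.inner_wordOp_wordMap (hwalk : FollowsWalk S E g ν) (hE : ∀ c, ‖E c‖ = 1)
    (τ : List (Fin N)) (c : M) :
    inner ℂ (E c) (wordOp S τ (E (wordMap g τ c))) = conj (wordWeight g ν τ c) := by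
  rw [hwalk.inner_wordOp_right, inner_self_eq_one_of_norm_eq_one (hE _), mul_one]

theorem FollowsWalk.inner_wordOp_of_isLoop (hwalk : FollowsWalk S E g ν) (hE : ∀ c, ‖E c‖ = 1)
    {c : M} {τ : List (Fin N)} (hτ : IsLoop g ν c τ) :
    inner ℂ (E c) (wordOp S τ (E c)) = conj (wordWeight g ν τ c) := by
  simpa only [(isLoop_iff.1 hτ).1] using hwalk.inner_wordOp_wordMap hE τ c

theorem FollowsWalk.isLoop_of_inner_ne_zero (hwalk : FollowsWalk S E g ν) (hE : Orthonormal ℂ E)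
    {c : M} {τ : List (Fin N)} (h : inner ℂ (E c) (wordOp S τ (E c)) ≠ 0) : IsLoop g ν c τ := by
  rw [hwalk.inner_wordOp_right, mul_ne_zero_iff, map_ne_zero] at h
  exact isLoop_iff.2 ⟨not_imp_comm.1 (fun hne => hE.2 hne) h.2, h.1⟩

theorem FollowsWalk.exists_isLoop_append_eq (hwalk : FollowsWalk S E g ν) (hS : IsCuntzFamily S)
    (hE : Orthonormal ℂ E) {c : M} {ω ω' : List (Fin N)}
    (h : inner ℂ (wordOp S ω (E c)) (wordOp S ω' (E c)) ≠ 0) :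
    ∃ τ τ', IsLoop g ν c τ ∧ IsLoop g ν c τ' ∧ ω ++ τ = ω' ++ τ' := by
  induction ω generalizing ω' with
  | nil => exact ⟨ω', [], hwalk.isLoop_of_inner_ne_zero hE h, isLoop_nil, by simp⟩
  | cons i ω ih =>
    cases ω' with
    | nil =>
      rw [ne_eq, inner_eq_zero_symm] at h
      exact ⟨[], i :: ω, isLoop_nil, hwalk.isLoop_of_inner_ne_zero hE h, by simp⟩
    | cons j ω' =>
      rw [wordOp_cons, wordOp_cons] at h
      obtain rfl : i = j := not_imp_comm.1 (fun hij => hS.inner_apply_of_ne hij _ _) h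
      rw [hS.inner_apply] at h
      obtain ⟨τ, τ', hτ, hτ', heq⟩ := ih h
      exact ⟨τ, τ', hτ, hτ', congrArg (List.cons i) heq⟩

theorem FollowsWalk.inner_wordOp_wordOp_append (hwalk : FollowsWalk S E g ν)
    (hS : IsCuntzFamily S) (hE : Orthonormal ℂ E) (hg : IsCodeterministic g ν) {c : M} {n : ℕ}
    {ω ω' γ : List (Fin N)} (hω : ω ∈ wordsEnding g ν c n) (hω' : ω' ∈ wordsEnding g ν c n)
    (hγ : IsLoop g ν c γ) :
    inner ℂ (wordOp S ω (E c)) (wordOp S (ω' ++ γ) (E c)) =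
      if ω = ω' then conj (wordWeight g ν γ c) else 0 := by
  split_ifs with hωω'
  · rw [hωω', wordOp_append, hS.inner_wordOp, hwalk.inner_wordOp_of_isLoop hE.1 hγ]
  · by_contra h
    obtain ⟨τ, τ', hτ, hτ', heq⟩ := hwalk.exists_isLoop_append_eq hS hE h
    rw [List.append_assoc] at heq
    exact hωω' (wordsEnding_eq_of_append_isLoop_eq hg hω hω' hτ (hγ.append_iff_right.2 hτ') heq)

theorem FollowsWalk.orthonormal_wordsEnding (hwalk : FollowsWalk S E g ν) (hS : IsCuntzFamily S)
    (hE : Orthonormal ℂ E) (hg : IsCodeterministic g ν) (c : M) (n : ℕ) :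
    Orthonormal ℂ fun ω : wordsEnding g ν c n => wordOp S (ω : List (Fin N)) (E c) := by
  rw [orthonormal_iff_ite]
  intro ω ω'
  simpa [wordWeight, Subtype.ext_iff] using
    hwalk.inner_wordOp_wordOp_append hS hE hg ω.2 ω'.2 isLoop_nil

theorem FollowsWalk.sum_norm_sq_eq_one (hwalk : FollowsWalk S E g ν) (hS : IsCuntzFamily S)
    (hE : ∀ c, ‖E c‖ = 1) (c : M) : ∑ i, ‖ν i c‖ ^ 2 = 1 := by
  simpa [hwalk _ c, norm_smul, hE] using hS.sum_norm_sq_adjoint_apply (E c)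

theorem FollowsWalk.norm_wordWeight_le_one (hwalk : FollowsWalk S E g ν) (hS : IsCuntzFamily S)
    (hE : ∀ c, ‖E c‖ = 1) (τ : List (Fin N)) (c : M) : ‖wordWeight g ν τ c‖ ≤ 1 := by
  rw [← RCLike.norm_conj, ← hwalk.inner_wordOp_wordMap hE]
  refine (norm_inner_le_norm _ _).trans_eq ?_
  rw [hS.norm_wordOp, hE, hE, one_mul]

theorem FollowsWalk.norm_wordWeight_lt_one (hwalk : FollowsWalk S E g ν) (hS : IsCuntzFamily S)
    (hE : ∀ c, ‖E c‖ = 1) {c : M} (hc : ∃ i j, i ≠ j ∧ ν i c ≠ 0 ∧ ν j c ≠ 0)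
    {τ : List (Fin N)} (hτ : τ ≠ []) : ‖wordWeight g ν τ c‖ < 1 := by
  obtain ⟨k, τ, rfl⟩ := List.exists_cons_of_ne_nil hτ
  obtain ⟨j, hkj, hj⟩ : ∃ j, k ≠ j ∧ ν j c ≠ 0 := by
    obtain ⟨i, j, hij, hi, hj⟩ := hc
    by_cases hki : k = i
    · exact ⟨j, hki ▸ hij, hj⟩
    · exact ⟨i, hki, hi⟩
  rw [wordWeight, norm_mul]
  exact mul_lt_one_of_nonneg_of_lt_one_left (norm_nonneg _)
    (norm_lt_one_of_sum_norm_sq_eq_one (hwalk.sum_norm_sq_eq_one hS hE c) hkj hj)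
    (hwalk.norm_wordWeight_le_one hS hE τ _)

theorem FollowsWalk.wordSpan_wordsEnding_ne_of_isCycleWord (hwalk : FollowsWalk S E g ν)
    (hS : IsCuntzFamily S) (hE : Orthonormal ℂ E) (hg : IsCodeterministic g ν) {c : M}
    {β : List (Fin N)} (hβ : IsCycleWord g ν c β) (hlt : ‖wordWeight g ν β c‖ < 1) (n : ℕ) :
    wordSpan S (E c) (wordsEnding g ν c n) ≠ wordSpan S (E c) Set.univ := by
  intro heq
  obtain ⟨b, hb⟩ : ∃ b, b ∈ wordsEnding g ν c n := ⟨_, flatten_replicate_mem_wordsEnding hβ n⟩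
  let x := wordOp S (b ++ β) (E c) - conj (wordWeight g ν β c) • wordOp S b (E c)
  have hx_mem : x ∈ wordSpan S (E c) (wordsEnding g ν c n) := heq ▸
    Submodule.sub_mem _ (wordOp_mem_wordSpan (Set.mem_univ _) _)
      (Submodule.smul_mem _ _ (wordOp_mem_wordSpan (Set.mem_univ _) _))
  have hx_orth : x ∈ (wordSpan S (E c) (wordsEnding g ν c n))ᗮ := by
    refine mem_orthogonal_wordSpan fun ω hω => ?_
    have hself := hwalk.inner_wordOp_wordOp_append hS hE hg hω hb isLoop_nil
    rw [List.append_nil] at hself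
    rw [inner_sub_right, inner_smul_right, hself,
      hwalk.inner_wordOp_wordOp_append hS hE hg hω hb hβ.isLoop]
    simp [wordWeight]
  have hx : x = 0 := Submodule.disjoint_def.1 (Submodule.orthogonal_disjoint _) x hx_mem hx_orth
  have hnorm := congrArg norm (sub_eq_zero.1 hx)
  rw [norm_smul, hS.norm_wordOp, hS.norm_wordOp, hE.1, mul_one, RCLike.norm_conj] at hnorm
  exact hlt.ne' hnorm

theorem FollowsWalk.wordSpan_wordsEnding_ne (hwalk : FollowsWalk S E g ν) (hS : IsCuntzFamily S)
    (hE : Orthonormal ℂ E) (hg : IsCodeterministic g ν) (hirr : IsIrreducibleWalk g ν) {c : M}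
    (hc : ∃ i j, i ≠ j ∧ ν i c ≠ 0 ∧ ν j c ≠ 0) (n : ℕ) :
    wordSpan S (E c) (wordsEnding g ν c n) ≠ wordSpan S (E c) Set.univ := by
  obtain ⟨β, hβ⟩ : ∃ β, IsCycleWord g ν c β :=
    let ⟨_, _, _, hi, _⟩ := hc
    hirr.exists_isCycleWord hi
  exact hwalk.wordSpan_wordsEnding_ne_of_isCycleWord hS hE hg hβ
    (hwalk.norm_wordWeight_lt_one hS hE.1 hc hβ.ne_nil) n

theorem FollowsWalk.wordOp_wordMap_eq_smul (hwalk : FollowsWalk S E g ν) (hS : IsCuntzFamily S)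
    (hE : ∀ c, ‖E c‖ = 1) {τ : List (Fin N)} {c : M} (hτ : ‖wordWeight g ν τ c‖ = 1) :
    wordOp S τ (E (wordMap g τ c)) = conj (wordWeight g ν τ c) • E c := by
  have hnorm : ‖conj (wordWeight g ν τ c) • E c‖ = 1 := by
    rw [norm_smul, RCLike.norm_conj, hτ, hE, one_mul]
  refine ((inner_eq_one_iff_of_norm_eq_one (𝕜 := ℂ) hnorm
    ((hS.norm_wordOp τ _).trans (hE _))).1 ?_).symm
  rw [inner_smul_left, hwalk.inner_wordOp_wordMap hE, RCLike.conj_mul, RCLike.norm_conj, hτ]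
  simp

theorem FollowsWalk.wordOp_eq_smul_of_isLoop (hwalk : FollowsWalk S E g ν) (hS : IsCuntzFamily S)
    (hE : ∀ c, ‖E c‖ = 1) (h01 : ∀ c i, ‖ν i c‖ = 0 ∨ ‖ν i c‖ = 1) {c : M} {γ : List (Fin N)}
    (hγ : IsLoop g ν c γ) : wordOp S γ (E c) = conj (wordWeight g ν γ c) • E c := by
  obtain ⟨hret, hpos⟩ := isLoop_iff.1 hγ
  simpa only [hret] using hwalk.wordOp_wordMap_eq_smul hS hE (norm_wordWeight_eq_one h01 hpos)

theorem FollowsWalk.exists_wordOp_append_eq_smul (hwalk : FollowsWalk S E g ν)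
    (hS : IsCuntzFamily S) (hE : ∀ c, ‖E c‖ = 1) (h01 : ∀ c i, ‖ν i c‖ = 0 ∨ ‖ν i c‖ = 1) {c : M}
    {γ : List (Fin N)} (hγ : IsLoop g ν c γ) (ω : List (Fin N)) :
    ∃ z : ℂ, ‖z‖ = 1 ∧ wordOp S (ω ++ γ) (E c) = z • wordOp S ω (E c) := by
  refine ⟨conj (wordWeight g ν γ c), ?_, ?_⟩
  · rw [RCLike.norm_conj, norm_wordWeight_eq_one h01 (isLoop_iff.1 hγ).2]
  · rw [wordOp_append, hwalk.wordOp_eq_smul_of_isLoop hS hE h01 hγ, map_smul]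

theorem FollowsWalk.wordSpan_wordsZero_eq (hwalk : FollowsWalk S E g ν) (hS : IsCuntzFamily S)
    (hE : ∀ c, ‖E c‖ = 1) (h01 : ∀ c i, ‖ν i c‖ = 0 ∨ ‖ν i c‖ = 1) (c : M) :
    wordSpan S (E c) (wordsZero g ν c) = wordSpan S (E c) Set.univ := by
  refine congrArg Submodule.topologicalClosure (le_antisymm
    (Submodule.span_mono (Set.image_mono (Set.subset_univ _))) (Submodule.span_le.2 ?_))
  rintro _ ⟨ω, -, rfl⟩
  obtain ⟨ω₀, hω₀, γ, hγ, rfl⟩ := exists_wordsZero_append_isLoop g ν c ω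
  obtain ⟨z, -, hz⟩ := hwalk.exists_wordOp_append_eq_smul hS hE h01 hγ ω₀
  simp only [hz]
  exact Submodule.smul_mem _ z (Submodule.subset_span (Set.mem_image_of_mem _ hω₀))

theorem apply_eq_of_apply_map_eq {K : Type*} [NormedAddCommGroup K] [InnerProductSpace ℂ K]
    [CompleteSpace K] {A : K →L[ℂ] K} {B : H →L[ℂ] H} {ι : K →ₗᵢ[ℂ] H}
    (hι : ∀ k, (B†) (ι k) = ι ((A†) k)) {x y : K} (h : B (ι x) = ι y) : A x = y := by
  refine ext_inner_left ℂ fun k => ?_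
  rw [← ContinuousLinearMap.adjoint_inner_left, ← ι.inner_map_map, ← hι,
    ContinuousLinearMap.adjoint_inner_left, h, ι.inner_map_map]

end Representation

end CuntzWalk

open CuntzWalk in
theorem proposition3p8_general {N : ℕ} {K H M : Type*}
    [NormedAddCommGroup K] [InnerProductSpace ℂ K] [CompleteSpace K]
    [NormedAddCommGroup H] [InnerProductSpace ℂ H] [CompleteSpace H] [Nonempty M]
    {V : Fin N → K →L[ℂ] K} {ι : K →ₗᵢ[ℂ] H} {S : Fin N → H →L[ℂ] H} (hS : IsCuntzFamily S)
    (hι : ∀ i k, ((S i)†) (ι k) = ι (((V i)†) k)) {e : M → K} (he : Orthonormal ℂ e)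
    {g : Fin N → M → M} {ν : Fin N → M → ℂ} (hV : FollowsWalk V e g ν)
    (hg : IsCodeterministic g ν) (hirr : IsIrreducibleWalk g ν) :
    ((∀ c i, ‖ν i c‖ = 0 ∨ ‖ν i c‖ = 1) →
      IsSingleCycle g ν ∧
      (∀ i c, ν i c ≠ 0 → V i (e (g i c)) = conj (ν i c) • e c) ∧
      (∀ (c : M) (ω γ : List (Fin N)), IsLoop g ν c γ →
        ∃ z : ℂ, ‖z‖ = 1 ∧ wordOp S (ω ++ γ) (ι (e c)) = z • wordOp S ω (ι (e c))) ∧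
      (∀ c : M,
        Orthonormal ℂ (fun ω : wordsZero g ν c => wordOp S (ω : List (Fin N)) (ι (e c))) ∧
        wordSpan S (ι (e c)) (wordsZero g ν c) = wordSpan S (ι (e c)) Set.univ)) ∧
    (∀ c : M, (∃ i j, i ≠ j ∧ ν i c ≠ 0 ∧ ν j c ≠ 0) →
      ∀ n : ℕ, wordSpan S (ι (e c)) (wordsEnding g ν c n) ≠ wordSpan S (ι (e c)) Set.univ) := by
  have hE : Orthonormal ℂ fun c => ι (e c) := he.comp_linearIsometry ι
  have hwalk : FollowsWalk S (fun c => ι (e c)) g ν := hV.map hι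
  refine ⟨fun h01 => ⟨?_, fun i c hi => ?_, fun c ω γ hγ => ?_, fun c => ⟨?_, ?_⟩⟩,
    fun c hc n => hwalk.wordSpan_wordsEnding_ne hS hE hg hirr hc n⟩
  · exact hirr.isSingleCycle fun c => exists_ne_zero_iff_eq_of_sum_norm_sq_eq_one
      (hwalk.sum_norm_sq_eq_one hS hE.1 c) (h01 c)
  · have hone : ‖wordWeight g ν [i] c‖ = 1 :=
      norm_wordWeight_eq_one h01 (mul_ne_zero hi one_ne_zero)
    refine apply_eq_of_apply_map_eq (hι i) ?_
    simpa [wordOp, wordMap, wordWeight] using hwalk.wordOp_wordMap_eq_smul hS hE.1 hone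
  · exact hwalk.exists_wordOp_append_eq_smul hS hE.1 h01 hγ ω
  · exact wordsEnding_zero g ν c ▸ hwalk.orthonormal_wordsEnding hS hE hg c 0
  · exact hwalk.wordSpan_wordsZero_eq hS hE.1 h01 c

theorem proposition3p8 {N : ℕ} {K H M : Type*}
    [NormedAddCommGroup K] [InnerProductSpace ℂ K] [CompleteSpace K]
    [NormedAddCommGroup H] [InnerProductSpace ℂ H] [CompleteSpace H]
    [Fintype M] [Nonempty M]
    (V : Fin N → K →L[ℂ] K) (hV : CuntzWalk.IsRowCoisometry V)
    (ι : K →ₗᵢ[ℂ] H) (S : Fin N → H →L[ℂ] H) (hS : CuntzWalk.IsCuntzDilation V ι S)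
    (K₀ : Submodule ℂ K) [CompleteSpace K₀] (e : OrthonormalBasis M ℂ K₀)
    (g : Fin N → M → M) (ν : Fin N → M → ℂ)
    (hwalk : CuntzWalk.ActsAsRandomWalk V K₀ e g ν)
    (hirr : CuntzWalk.IsIrreducibleWalk g ν)
    (hsimple : CuntzWalk.IsSimpleOn V K₀) :
    ((∀ c i, ‖ν i c‖ = 0 ∨ ‖ν i c‖ = 1) →
      CuntzWalk.IsSingleCycle g ν ∧
      CuntzWalk.IsReversing V e g ν ∧
      (∀ (c : M) (n : ℕ) (ω₀ γ : List (Fin N)), ω₀ ∈ CuntzWalk.wordsZero g ν c →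
        CuntzWalk.IsLoop g ν c γ → ω₀ ++ γ ∈ CuntzWalk.wordsEnding g ν c n →
        ∃ z : ℂ, ‖z‖ = 1 ∧
          CuntzWalk.wordOp S (ω₀ ++ γ) (ι (e c)) = z • CuntzWalk.wordOp S ω₀ (ι (e c))) ∧
      (∀ c : M,
        Orthonormal ℂ
          (fun ω : CuntzWalk.wordsZero g ν c => CuntzWalk.wordOp S (ω : List (Fin N)) (ι (e c))) ∧
        CuntzWalk.wordSpan S (ι (e c)) (CuntzWalk.wordsZero g ν c) =
          CuntzWalk.wordSpan S (ι (e c)) Set.univ)) ∧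
    (∀ c : M, (∃ i j, i ≠ j ∧ ν i c ≠ 0 ∧ ν j c ≠ 0) →
      ∀ n : ℕ, CuntzWalk.wordSpan S (ι (e c)) (CuntzWalk.wordsEnding g ν c n) ≠
        CuntzWalk.wordSpan S (ι (e c)) Set.univ) := by
  obtain ⟨hunimodular, hbranching⟩ := proposition3p8_general hS.cuntz hS.adjoint_apply
    (e.orthonormal.comp_linearIsometry K₀.subtypeₗᵢ) hwalk.adjoint_apply hwalk.injective hirr
  refine ⟨fun h01 => ?_, hbranching⟩
  obtain ⟨hcycle, hreversing, hloop, hbasis⟩ := hunimodular h01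
  exact ⟨hcycle, hreversing, fun c _ ω₀ γ _ hγ _ => hloop c ω₀ γ hγ, hbasis⟩
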